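/- Let $K$ be a field and let $f\in K(z)$ be a separable rational function (that is, $f'\neq 0$) of degree $d\ge 2$. Let $t$ be transcendental over $K$, fix a separable closure $K(t)^{\mathrm{sep}}$ of $K(t)$, and let $K^{\mathrm{sep}}$ be the separable closure of $K$ in it. Let $f^{-n}(t)\subseteq K(t)^{\mathrm{sep}}$ be the set of solutions $x$ of $f^n(x)=t$, where $f^n$ is the $n$-th iterate, and write $f^{-1}(t)=\{t_1,\dots,t_d\}$. A system of paths $\Lambda=(\lambda_i)_{i=1}^d$ consists of $K^{\mathrm{sep}}$-automorphisms $\lambda_i$ of $K(t)^{\mathrm{sep}}=K(t_i)^{\mathrm{sep}}$ with $\lambda_i(t)=t_i$. It identifies the $d$-adic tree $T$ of finite words over $\{1,\dots,d\}$ with the tree of preimages $\bigsqcup_{n\ge 0}f^{-n}(t)$, the word $i_1\cdots i_n$ corresponding to $\lambda_{i_1}(\cdots\lambda_{i_n}(t)\cdots)$. For a field $K\subseteq F\subseteq K^{\mathrm{sep}}$, let $G_\infty(F,f,t)\le \mathrm{Aut}\,T$ be the image of the action $\rho:\mathrm{Gal}(K(t)^{\mathrm{sep}}/F(t))\to\mathrm{Aut}\,T$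 on the tree of preimages, transported by this identification. For $g\in\mathrm{Aut}\,T$ and $v\in T$, the section $g|_v\in\mathrm{Aut}\,T$ is defined by $g(vw)=g(v)\,g|_v(w)$ for all words $w$. A subgroup of $\mathrm{Aut}\,T$ is self-similar if it contains all sections of its elements. For self-similar subgroups $1\ne H\trianglelefteq G\le\mathrm{Aut}\,T$ put $$G_H:=\{g\in G\mid (g|_v)(g|_w)^{-1}\in H\text{ for all }v,w\in T\}.$$ For $1\le n\le\infty$ let $K_n(f,t)$ be the field generated over $K(t)$ by all the sets $f^{-k}(t)$ with $k\le n$ ($k$ finite), and let $L_n:=K^{\mathrm{sep}}\cap K_n(f,t)$. Then systems of paths exist, and for every system of paths and every $1\le n\le\infty$ the following holds: $1\ne G_\infty(L_n,f,t)\trianglelefteq G_\infty(K,f,t)$ are self-similar subgroups of $\mathrm{Aut}\,T$, so that $$G_n^K:=G_\infty(K,f,t)_{G_\infty(L_n,f,t)}$$ is defined, and $$G_\infty(K,f,t)=G_n^K .$$ -/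

import Mathlib

namespace Arboreal

/-! ### The rooted tree of words and its automorphisms -/

/-- The automorphism group of the rooted tree whose vertices are the finite words over `X`
(the root is the empty word, the `n`th level consists of the words of length `n`, and `w` is a
descendant of `v` iff `v` is a prefix of `w`). For `X = Fin d` this is the `d`-adic tree. -/
def TreeAut (X : Type*) : Subgroup (Equiv.Perm (List X)) where
  carrier := {g | (∀ v, (g v).length = v.length) ∧ ∀ v w, g v <+: g w ↔ v <+: w}
  one_mem' := by simp
  mul_mem' := by
    rintro a b ⟨ha, ha'⟩ ⟨hb, hb'⟩
    exact ⟨fun v => by simp [ha, hb], fun v w => by simp [ha', hb']⟩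
  inv_mem' := by
    rintro a ⟨ha, ha'⟩
    refine ⟨fun v => ?_, fun v w => ?_⟩
    · rw [← ha, Equiv.Perm.inv_def, Equiv.apply_symm_apply]
    · rw [← ha', Equiv.Perm.inv_def, Equiv.apply_symm_apply, Equiv.apply_symm_apply]

namespace TreeAut

variable {X : Type*}

theorem append_drop (g : TreeAut X) (v w : List X) :
    g.1 v ++ (g.1 (v ++ w)).drop v.length = g.1 (v ++ w) := by
  obtain ⟨u, hu⟩ := (g.2.2 v (v ++ w)).2 (List.prefix_append v w)
  rw [← hu, List.drop_left' (g.2.1 v)]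

/-- The section `g|_v` of `g` at the vertex `v`: the automorphism with
`g (v w) = g (v) g|_v (w)` for all words `w`, see `apply_append`. -/
def sec (g : TreeAut X) (v : List X) : TreeAut X :=
  ⟨{  toFun := fun w => (g.1 (v ++ w)).drop v.length
      invFun := fun w => (g.1.symm (g.1 v ++ w)).drop v.length
      left_inv := fun w => by
        simp only [append_drop, Equiv.symm_apply_apply, List.drop_left]
      right_inv := fun w => by
        have h : v <+: g.1.symm (g.1 v ++ w) := by
          rw [← g.2.2, Equiv.apply_symm_apply]
          exact List.prefix_append _ _
        obtain ⟨u, hu⟩ := h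
        simp only [← hu, List.drop_left]
        rw [hu, Equiv.apply_symm_apply, List.drop_left' (g.2.1 v)] },
    by
      refine ⟨fun w => ?_, fun w u => ?_⟩
      · simp [g.2.1]
      · have h := g.2.2 (v ++ w) (v ++ u)
        rw [← append_drop g v w, ← append_drop g v u] at h
        simpa [List.prefix_append_right_inj] using h⟩

theorem apply_append (g : TreeAut X) (v w : List X) :
    g.1 (v ++ w) = g.1 v ++ (sec g v).1 w :=
  (append_drop g v w).symm

end TreeAut

/-- A subgroup of the automorphism group of the tree is self-similar if it contains all the
sections of its elements. -/
def IsSelfSimilar {X : Type*} (G : Subgroup (TreeAut X)) : Prop :=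
  ∀ g ∈ G, ∀ v : List X, TreeAut.sec g v ∈ G

/-- `1 ≠ H ⊴ G` are self-similar subgroups of the automorphism group of the tree: the standing
assumption under which the group `G_H` is formed. -/
structure IsSelfSimilarPair {X : Type*} (G H : Subgroup (TreeAut X)) : Prop where
  ne_bot : H ≠ ⊥
  le : H ≤ G
  normal : (H.subgroupOf G).Normal
  selfSimilar_left : IsSelfSimilar G
  selfSimilar_right : IsSelfSimilar H

/-- The group `G_H = {g ∈ G | (g|_v) (g|_w)⁻¹ ∈ H for all vertices v, w}` (its underlying set).
As `H` is normal in `G` and `G` is self-similar, the condition does not depend on whether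
automorphisms are composed from left to right or from right to left. -/
def intermediate {X : Type*} (G H : Subgroup (TreeAut X)) : Set (TreeAut X) :=
  {g | g ∈ G ∧ ∀ v w : List X, TreeAut.sec g v * (TreeAut.sec g w)⁻¹ ∈ H}

/-! ### Rational functions and trees of preimages -/

section Preimages

variable {K Ω : Type*} [Field K] [Field Ω] [Algebra K Ω]

/-- The degree of a rational function as a self-map of the projective line. -/
noncomputable def ratDegree (f : RatFunc K) : ℕ :=
  max f.num.natDegree f.denom.natDegree

/-- The rational function `f` is separable: its formal derivative does not vanish (the
numerator of `f'` is nonzero). -/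
def IsSeparableMap (f : RatFunc K) : Prop :=
  f.num.derivative * f.denom - f.num * f.denom.derivative ≠ 0

/-- The value `f(x)`. At a pole this is `0`; this never matters for the sets `f⁻ⁿ(t)` with
`t` transcendental over `K`, as no point over `t` is algebraic over `K` and so neither it nor
any of its iterated images is a pole of `f`, while the iterates of `0` are algebraic. -/
noncomputable def value (f : RatFunc K) (x : Ω) : Ω :=
  Polynomial.aeval x f.num / Polynomial.aeval x f.denom

/-- The set of vertices of the tree of preimages `⨆ₙ f⁻ⁿ(t)` (disjoint union). -/
def PreimageTree (f : RatFunc K) (t : Ω) : Type _ :=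
  {p : ℕ × Ω // (value f)^[p.1] p.2 = t}

theorem value_map (f : RatFunc K) (σ : Ω ≃ₐ[K] Ω) (x : Ω) :
    value f (σ x) = σ (value f x) := by
  simp only [value, map_div₀]
  rw [← AlgEquiv.coe_toAlgHom, Polynomial.aeval_algHom_apply, Polynomial.aeval_algHom_apply]

theorem value_iterate_map (f : RatFunc K) (σ : Ω ≃ₐ[K] Ω) (n : ℕ) (x : Ω) :
    (value f)^[n] (σ x) = σ ((value f)^[n] x) :=
  ((show Function.Semiconj σ (value f) (value f) from
    fun x => (value_map f σ x).symm).iterate_right n x).symm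

/-- The natural action of `Gal(Ω/K)_t` on the tree of preimages of `t`, one automorphism at a
time. -/
def galPerm (f : RatFunc K) {t : Ω} (σ : Ω ≃ₐ[K] Ω) (hσ : σ t = t) :
    Equiv.Perm (PreimageTree f t) where
  toFun p := ⟨(p.1.1, σ p.1.2), by
    have h := p.2
    rw [value_iterate_map, h, hσ]⟩
  invFun p := ⟨(p.1.1, σ.symm p.1.2), by
    have h := p.2
    rw [value_iterate_map, h, AlgEquiv.symm_apply_eq, hσ]⟩
  left_inv p := Subtype.ext (Prod.ext rfl (σ.symm_apply_apply _))
  right_inv p := Subtype.ext (Prod.ext rfl (σ.apply_symm_apply _))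

/-- A choice, for each of the points `t_i ∈ f⁻¹(t)`, of a path from `t` to `t_i`.
Here `Ω` is a separable closure of `K(t)`; it is then also a separable closure of each `K(t_i)`,
as `t = f(t_i)`, and `separableClosure K Ω` is the separable closure of `K` in `Ω`. -/
structure PathSystem (f : RatFunc K) (t : Ω) where
  /-- the enumeration `t_1, …, t_d` of `f⁻¹(t)`, where `d = deg f` -/
  point : Fin (ratDegree f) ≃ {x : Ω // value f x = t}
  /-- the path `λ_i`, a `K^sep`-isomorphism `K(t)^sep → K(t_i)^sep` -/
  path : Fin (ratDegree f) → (Ω ≃ₐ[separableClosure K Ω] Ω)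
  path_apply : ∀ i, path i t = (point i).1

namespace PathSystem

variable {f : RatFunc K} {t : Ω} (Λ : PathSystem f t)

/-- The point `t_v` over `t` labelled by the word `v = i_1 … i_n`, that is,
`λ_{i_1} (λ_{i_2} (… λ_{i_n} (t)))`. -/
def pt : List (Fin (ratDegree f)) → Ω
  | [] => t
  | i :: v => Λ.path i (pt v)

/-- The path `λ_i` as a `K`-automorphism. -/
def pathK (i : Fin (ratDegree f)) : Ω ≃ₐ[K] Ω := (Λ.path i).restrictScalars K

theorem iterate_path (i : Fin (ratDegree f)) (n : ℕ) (x : Ω) :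
    (value f)^[n] (Λ.path i x) = Λ.path i ((value f)^[n] x) :=
  value_iterate_map f (Λ.pathK i) n x

theorem value_path (i : Fin (ratDegree f)) : value f (Λ.path i t) = t := by
  rw [Λ.path_apply]; exact (Λ.point i).2

theorem iterate_pt_append (v w : List (Fin (ratDegree f))) :
    (value f)^[w.length] (Λ.pt (v ++ w)) = Λ.pt v := by
  induction v with
  | nil =>
    induction w with
    | nil => rfl
    | cons i w ih =>
      simp only [List.nil_append] at ih
      simp only [List.nil_append, List.length_cons, pt, Function.iterate_succ_apply',
        iterate_path, ih, value_path]
  | cons i v ih => rw [List.cons_append, pt, pt, iterate_path, ih]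

theorem iterate_pt (v : List (Fin (ratDegree f))) : (value f)^[v.length] (Λ.pt v) = t :=
  Λ.iterate_pt_append [] v

theorem pt_injective : ∀ v w : List (Fin (ratDegree f)), v.length = w.length →
    Λ.pt v = Λ.pt w → v = w
  | [], w, h, _ => (List.length_eq_zero_iff.1 h.symm).symm
  | i :: v, [], h, _ => by simp at h
  | i :: v, j :: w, h, e => by
    have hl : v.length = w.length := by simpa using h
    have key : Λ.path i t = Λ.path j t := by
      have h1 := congrArg ((value f)^[v.length]) e
      rw [pt, pt, iterate_path, iterate_path, iterate_pt, hl, iterate_pt] at h1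
      exact h1
    have hij : i = j := by
      rw [Λ.path_apply, Λ.path_apply] at key
      exact Λ.point.injective (Subtype.ext key)
    subst hij
    rw [pt_injective v w hl ((Λ.path i).injective e)]

theorem pt_surjective : ∀ (n : ℕ) (x : Ω), (value f)^[n] x = t →
    ∃ v : List (Fin (ratDegree f)), v.length = n ∧ Λ.pt v = x
  | 0, x, h => ⟨[], rfl, h.symm⟩
  | n + 1, x, h => by
    rw [Function.iterate_succ_apply'] at h
    obtain ⟨i, hi⟩ := Λ.point.surjective ⟨_, h⟩
    have h1 : Λ.path i t = (value f)^[n] x := by rw [Λ.path_apply, hi]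
    obtain ⟨v, hv, hx⟩ := pt_surjective n ((Λ.path i).symm x) (by
      apply (Λ.path i).injective
      rw [← iterate_path, AlgEquiv.apply_symm_apply, h1])
    exact ⟨i :: v, by simp [hv], by rw [pt, hx, AlgEquiv.apply_symm_apply]⟩

/-- The identification, determined by the paths, of the `d`-adic tree of words with the tree of
preimages of `t`. -/
noncomputable def label : List (Fin (ratDegree f)) ≃ PreimageTree f t :=
  Equiv.ofBijective (fun v => ⟨(v.length, Λ.pt v), Λ.iterate_pt v⟩) <| by
    constructor
    · intro v w h
      have h' := congrArg Subtype.val h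
      simp only [Prod.mk.injEq] at h'
      exact Λ.pt_injective v w h'.1 h'.2
    · rintro ⟨⟨n, x⟩, h⟩
      obtain ⟨v, hv, hx⟩ := Λ.pt_surjective n x h
      exact ⟨v, Subtype.ext (Prod.ext hv hx)⟩

theorem label_val (v : List (Fin (ratDegree f))) : (Λ.label v).1 = (v.length, Λ.pt v) := rfl

theorem label_symm_length (p : PreimageTree f t) : (Λ.label.symm p).length = p.1.1 := by
  conv_rhs => rw [← Λ.label.apply_symm_apply p, label_val]

theorem pt_label_symm (p : PreimageTree f t) : Λ.pt (Λ.label.symm p) = p.1.2 := by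
  conv_rhs => rw [← Λ.label.apply_symm_apply p, label_val]

theorem prefix_iff (v w : List (Fin (ratDegree f))) :
    v <+: w ↔ v.length ≤ w.length ∧ (value f)^[w.length - v.length] (Λ.pt w) = Λ.pt v := by
  constructor
  · rintro ⟨u, rfl⟩
    refine ⟨by simp, ?_⟩
    rw [List.length_append, Nat.add_sub_cancel_left, iterate_pt_append]
  · rintro ⟨hle, h⟩
    have hd : (w.drop v.length).length = w.length - v.length := by simp
    have e := Λ.iterate_pt_append (w.take v.length) (w.drop v.length)
    rw [List.take_append_drop, hd, h] at e
    have := Λ.pt_injective _ _ (by simp [hle]) e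
    rw [this]
    exact List.take_prefix _ _

/-- The automorphism of the tree of words induced by a `K`-automorphism fixing `t`. -/
noncomputable def treeAut (σ : Ω ≃ₐ[K] Ω) (hσ : σ t = t) : TreeAut (Fin (ratDegree f)) :=
  ⟨(Λ.label.trans (galPerm f σ hσ)).trans Λ.label.symm, by
    have hlen : ∀ v, (((Λ.label.trans (galPerm f σ hσ)).trans Λ.label.symm) v).length
        = v.length := fun v => by
      rw [Equiv.trans_apply, label_symm_length]; rfl
    have hpt : ∀ v, Λ.pt (((Λ.label.trans (galPerm f σ hσ)).trans Λ.label.symm) v)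
        = σ (Λ.pt v) := fun v => by
      rw [Equiv.trans_apply, pt_label_symm]; rfl
    refine ⟨hlen, fun v w => ?_⟩
    rw [Λ.prefix_iff, Λ.prefix_iff, hlen, hlen, hpt, hpt, value_iterate_map,
      EmbeddingLike.apply_eq_iff_eq]⟩

theorem pt_treeAut (σ : Ω ≃ₐ[K] Ω) (hσ : σ t = t) (v : List (Fin (ratDegree f))) :
    Λ.pt ((Λ.treeAut σ hσ).1 v) = σ (Λ.pt v) :=
  Λ.pt_label_symm (galPerm f σ hσ (Λ.label v))

section Galois

variable (F : Type*) [Field F] [Algebra K F] [Algebra F Ω] [IsScalarTower K F Ω]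

theorem gal_fix (σ : Ω ≃ₐ[IntermediateField.adjoin F {t}] Ω) :
    ((σ.restrictScalars F).restrictScalars K) t = t :=
  σ.commutes ⟨t, IntermediateField.mem_adjoin_simple_self F t⟩

/-- The arboreal Galois representation `ρ : Gal(F(t)^sep/F(t)) → Aut T`, for a field `F` over
`K` with `F ⊆ K^sep`, so that `Ω` is a separable closure of `F(t)`; the tree of preimages of `t`
is identified with the tree of words by the chosen paths. -/
noncomputable def rho :
    (Ω ≃ₐ[IntermediateField.adjoin F {t}] Ω) →* TreeAut (Fin (ratDegree f)) where
  toFun σ := Λ.treeAut ((σ.restrictScalars F).restrictScalars K) (gal_fix F σ)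
  map_one' := by
    refine Subtype.ext (Equiv.ext fun v => ?_)
    exact Λ.label.symm_apply_apply v
  map_mul' σ τ := by
    refine Subtype.ext (Equiv.ext fun v => ?_)
    change _ = Λ.label.symm (galPerm f _ (gal_fix F σ)
      (Λ.label (Λ.label.symm (galPerm f _ (gal_fix F τ) (Λ.label v)))))
    rw [Equiv.apply_symm_apply]
    rfl

/-- The iterated Galois group `G_∞(F, f, t)`. -/
noncomputable def iteratedGaloisGroup : Subgroup (TreeAut (Fin (ratDegree f))) :=
  (Λ.rho F).range

end Galois

end PathSystem

/-- The splitting field `K_n(f,t)` over `K(t)` of the iterates `f^k` with `k ≤ n`, that is, the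
field generated over `K(t)` by all the preimages of `t` under these iterates. -/
noncomputable def splittingField (f : RatFunc K) (t : Ω) (n : ℕ∞) : IntermediateField K Ω :=
  IntermediateField.adjoin K
    ({t} ∪ {x : Ω | ∃ k : ℕ, (k : ℕ∞) ≤ n ∧ (value f)^[k] x = t})

/-- The field `L_n = K^sep ∩ K_n(f,t)`. -/
noncomputable def constantField (f : RatFunc K) (t : Ω) (n : ℕ∞) : IntermediateField K Ω :=
  separableClosure K Ω ⊓ splittingField f t n

end Preimages

end Arboreal

/-!
A path system conjugates the Galois action into sections: if `σ` fixes `t` and `w` is the image of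
the word `v` under `σ`, then the section at `v` of the tree automorphism of `σ` is the tree
automorphism of `λ_w⁻¹ σ λ_v`, where `λ_v` is the composite of the paths along `v`. The paths are
the identity on `K^sep`, so this conjugate agrees with `σ` there. Hence all sections of one element
differ by automorphisms trivial on `K^sep`, and such automorphisms lie in `G_∞(L, f, t)` for every
`L ⊆ K^sep`.

Paths exist because the fibre polynomial `num f - t · denom f` is separable of degree `d`: a double
root would be a zero of `f'`, hence algebraic over `K`, while points over `t` are transcendental.
Finally `G_∞(L, f, t) ≠ 1`: otherwise some `s ∈ f⁻¹(t)` would lie in `L(t) = L(f(s))`, although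
`[L(s) : L(f(s))] = d ≥ 2`.
-/

namespace Arboreal

open IntermediateField Polynomial

section SeparableClosures

theorem isSepClosure_of_le {K Ω : Type*} [Field K] [Field Ω] [Algebra K Ω]
    {E E' : IntermediateField K Ω} (h : E ≤ E') [hE : IsSepClosure E Ω] : IsSepClosure E' Ω := by
  let _ : Algebra E E' := (inclusion h).toAlgebra
  have : IsScalarTower E E' Ω := .of_algebraMap_eq fun _ => rfl
  exact ⟨hE.sep_closed, Algebra.isSeparable_tower_top_of_isSeparable E E' Ω⟩

theorem map_mem_separableClosure {K Ω : Type*} [Field K] [Field Ω] [Algebra K Ω] (σ : Gal(Ω/K))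
    {x : Ω} (hx : x ∈ separableClosure K Ω) : σ x ∈ separableClosure K Ω :=
  (map_mem_separableClosure_iff σ.toAlgHom).2 hx

theorem algebraMap_mem_separableClosure {K F Ω : Type*} [Field K] [Field F] [Field Ω]
    [Algebra K F] [Algebra K Ω] [Algebra F Ω] [IsScalarTower K F Ω] [Algebra.IsSeparable K F]
    (x : F) : algebraMap F Ω x ∈ separableClosure K Ω :=
  mem_separableClosure_iff.2 <| (Algebra.IsSeparable.isSeparable K x).map
    (IsScalarTower.toAlgHom K F Ω) (algebraMap F Ω).injective

variable {F M N : Type*} [Field F] [Field M] [Field N] [Algebra F M] [Algebra F N]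

theorem exists_algEquiv_extending {A B : Type*} [Field A] [Field B] [Algebra F A] [Algebra F B]
    [Algebra A M] [Algebra B N] [IsScalarTower F A M] [IsScalarTower F B N]
    [IsSepClosure A M] [hN : IsSepClosure B N] (e : A ≃ₐ[F] B) :
    ∃ φ : M ≃ₐ[F] N, ∀ a, φ (algebraMap A M a) = algebraMap B N (e a) := by
  let _ : Algebra A N := ((algebraMap B N).comp (e : A →+* B)).toAlgebra
  have algebraMap_eq (a : A) : algebraMap A N a = algebraMap B N (e a) := rfl
  have : IsScalarTower F A N := .of_algebraMap_eq fun c => by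
    rw [algebraMap_eq, e.commutes, ← IsScalarTower.algebraMap_apply]
  have : Algebra.IsSeparable A N :=
    .of_equiv_equiv e.symm.toRingEquiv (RingEquiv.refl N) <| RingHom.ext fun b =>
      (algebraMap_eq _).trans (congrArg _ (e.apply_symm_apply b))
  have : IsSepClosure A N := ⟨hN.sep_closed, inferInstance⟩
  exact ⟨(IsSepClosure.equiv A M N).restrictScalars F, (IsSepClosure.equiv A M N).commutes⟩

theorem exists_algEquiv_apply_eq_of_transcendental {s : M} {t : N} (hs : Transcendental F s)
    (ht : Transcendental F t) [IsSepClosure F⟮s⟯ M] [IsSepClosure F⟮t⟯ N] :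
    ∃ φ : M ≃ₐ[F] N, φ s = t := by
  let es := RatFunc.algEquivOfTranscendental s hs
  let et := RatFunc.algEquivOfTranscendental t ht
  obtain ⟨φ, hφ⟩ := exists_algEquiv_extending (M := M) (N := N) (es.symm.trans et)
  refine ⟨φ, ?_⟩
  calc φ s = et (es.symm (AdjoinSimple.gen F s)) := hφ (AdjoinSimple.gen F s)
    _ = et RatFunc.X := by rw [RatFunc.algEquivOfTranscendental_symm_gen]
    _ = t := RatFunc.algEquivOfTranscendental_X t ht

end SeparableClosures

section Values

variable {K : Type*} [Field K] (f : RatFunc K)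

theorem map_value {A B : Type*} [Field A] [Field B] [Algebra K A] [Algebra K B] (φ : A →ₐ[K] B)
    (x : A) : φ (value f x) = value f (φ x) := by
  simp only [value, map_div₀, aeval_algHom_apply]

theorem value_mem_adjoin_simple (F : Type*) {Ω : Type*} [Field F] [Field Ω] [Algebra K F]
    [Algebra K Ω] [Algebra F Ω] [IsScalarTower K F Ω] (s : Ω) : value f s ∈ F⟮s⟯ :=
  (mem_adjoin_simple_iff F _).2 ⟨f.num.map (algebraMap K F), f.denom.map (algebraMap K F), by
    simp only [aeval_map_algebraMap, value]⟩

variable {f} {Ω : Type*} [Field Ω] [Algebra K Ω]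

theorem transcendental_of_value {s : Ω} (h : Transcendental K (value f s)) :
    Transcendental K s := fun hs =>
  have := isAlgebraic_adjoin_simple hs.isIntegral
  h <| (Algebra.IsAlgebraic.isAlgebraic (⟨_, value_mem_adjoin_simple f K s⟩ : K⟮s⟯)).algebraMap

end Values

section Fibres

variable {K Ω : Type*} [Field K] [Field Ω] [Algebra K Ω]

/-- The polynomial `num f - t · denom f`, whose roots are the points of `f⁻¹(t)`; it is used to
count them. -/
noncomputable def fibrePoly (f : RatFunc K) (t : Ω) : Polynomial Ω :=
  f.num.map (algebraMap K Ω) - C t * f.denom.map (algebraMap K Ω)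

theorem aeval_fibrePoly_eq_zero_iff (f : RatFunc K) {t : Ω} (ht : t ≠ 0) {A : Type*} [Field A]
    [Algebra K A] [Algebra Ω A] [IsScalarTower K Ω A] (x : A) :
    aeval x (fibrePoly f t) = 0 ↔ value f x = algebraMap Ω A t := by
  have ht' : algebraMap Ω A t ≠ 0 := (_root_.map_ne_zero _).2 ht
  simp only [fibrePoly, map_sub, map_mul, aeval_C, aeval_map_algebraMap, sub_eq_zero, value]
  by_cases hx : aeval x f.denom = 0
  · have : aeval x f.num ≠ 0 :=
      (aeval_ne_zero_of_isCoprime f.isCoprime_num_denom x).resolve_right (not_not.2 hx)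
    simp only [hx, mul_zero, div_zero, this, ht'.symm]
  · rw [div_eq_iff hx]

theorem algebraMap_sub_mul_algebraMap_ne_zero {t : Ω} (ht : Transcendental K t) {a b : K}
    (h : a ≠ 0 ∨ b ≠ 0) : algebraMap K Ω a - t * algebraMap K Ω b ≠ 0 := by
  intro h0
  have hp : (C a - X * C b : K[X]) = 0 := transcendental_iff.1 ht _ <| by
    simpa only [map_sub, map_mul, aeval_C, aeval_X] using h0
  have ha : a = 0 := by simpa using congrArg (coeff · 0) hp
  have hb : b = 0 := by simpa [coeff_C] using congrArg (coeff · 1) hp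
  exact h.elim (· ha) (· hb)

theorem natDegree_fibrePoly (f : RatFunc K) {t : Ω} (ht : Transcendental K t) :
    (fibrePoly f t).natDegree = ratDegree f := by
  refine le_antisymm ?_ (le_natDegree_of_ne_zero ?_)
  · exact (natDegree_sub_le _ _).trans <|
      max_le_max natDegree_map_le ((natDegree_C_mul_le _ _).trans natDegree_map_le)
  · simp only [fibrePoly, coeff_sub, coeff_C_mul, coeff_map]
    refine algebraMap_sub_mul_algebraMap_ne_zero ht ?_
    rcases le_or_gt f.num.natDegree f.denom.natDegree with h | h
    · right
      rw [ratDegree, max_eq_right h]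
      exact leadingCoeff_ne_zero.2 f.denom_ne_zero
    · left
      rw [ratDegree, max_eq_left h.le]
      exact leadingCoeff_ne_zero.2 (ne_zero_of_natDegree_gt h)

theorem derivative_fibrePoly_mul_sub (f : RatFunc K) (t : Ω) :
    derivative (fibrePoly f t) * f.denom.map (algebraMap K Ω) -
        fibrePoly f t * derivative (f.denom.map (algebraMap K Ω)) =
      (derivative f.num * f.denom - f.num * derivative f.denom).map (algebraMap K Ω) := by
  simp only [fibrePoly, derivative_sub, derivative_C_mul, derivative_map, Polynomial.map_sub,
    Polynomial.map_mul]
  ring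

theorem separable_fibrePoly {f : RatFunc K} (hf : IsSeparableMap f) {t : Ω}
    (ht : Transcendental K t) : (fibrePoly f t).Separable := by
  rw [separable_def, isCoprime_iff_aeval_ne_zero_of_isAlgClosed Ω (AlgebraicClosure Ω)]
  have ht0 : t ≠ 0 := fun h => ht (h ▸ isAlgebraic_zero)
  intro x
  by_contra! hx
  obtain ⟨hroot, hderiv⟩ := hx
  have halg : IsAlgebraic K x := ⟨_, hf, by
    rw [← aeval_map_algebraMap Ω, ← derivative_fibrePoly_mul_sub f t, map_sub, map_mul, map_mul,
      hroot, hderiv, zero_mul, zero_mul, sub_zero]⟩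
  have hvalue : value f x = algebraMap Ω _ t := (aeval_fibrePoly_eq_zero_iff f ht0 x).1 hroot
  refine transcendental_of_value (f := f) (s := x) ?_ halg
  rw [hvalue]
  exact (transcendental_algebraMap_iff (algebraMap Ω _).injective).2 ht

theorem nonempty_fin_equiv_fibre [IsSepClosed Ω] {f : RatFunc K} (hf : IsSeparableMap f) {t : Ω}
    (ht : Transcendental K t) : Nonempty (Fin (ratDegree f) ≃ {x : Ω // value f x = t}) := by
  have ht0 : t ≠ 0 := fun h => ht (h ▸ isAlgebraic_zero)
  have hsep := separable_fibrePoly hf ht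
  have hcard : Fintype.card ((fibrePoly f t).rootSet Ω) = ratDegree f := by
    rw [card_rootSet_eq_natDegree hsep (IsSepClosed.splits_codomain _ hsep),
      natDegree_fibrePoly f ht]
  refine ⟨(Fintype.equivFinOfCardEq hcard).symm.trans (Equiv.subtypeEquivRight fun x => ?_)⟩
  exact (mem_rootSet_of_ne hsep.ne_zero).trans (aeval_fibrePoly_eq_zero_iff f ht0 x)

end Fibres

section Paths

variable {K Ω : Type*} [Field K] [Field Ω] [Algebra K Ω]

theorem isSepClosure_adjoin_simple (F : Type*) [Field F] [Algebra K F] [Algebra F Ω]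
    [IsScalarTower K F Ω] {s t : Ω} (h : t ∈ F⟮s⟯) [IsSepClosure K⟮t⟯ Ω] :
    IsSepClosure F⟮s⟯ Ω :=
  isSepClosure_of_le (E := K⟮t⟯) (E' := F⟮s⟯.restrictScalars K) (adjoin_simple_le_iff.2 h)

theorem exists_path (f : RatFunc K) {s t : Ω} (ht : Transcendental K t) (h : value f s = t)
    [IsSepClosure K⟮t⟯ Ω] : ∃ φ : Ω ≃ₐ[separableClosure K Ω] Ω, φ t = s := by
  subst h
  have := isSepClosure_adjoin_simple (K := K) (separableClosure K Ω)
    (value_mem_adjoin_simple f _ s)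
  have := isSepClosure_adjoin_simple (K := K) (separableClosure K Ω)
    (mem_adjoin_simple_self _ (value f s))
  exact exists_algEquiv_apply_eq_of_transcendental (ht.extendScalars _)
    ((transcendental_of_value ht).extendScalars _)

theorem nonempty_pathSystem {f : RatFunc K} (hf : IsSeparableMap f) {t : Ω}
    (ht : Transcendental K t) [hΩ : IsSepClosure K⟮t⟯ Ω] : Nonempty (PathSystem f t) := by
  have := hΩ.sep_closed
  obtain ⟨point⟩ := nonempty_fin_equiv_fibre hf ht
  choose path path_apply using fun i => exists_path f ht (point i).2
  exact ⟨⟨point, path, path_apply⟩⟩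

end Paths

section Degree

variable {K F : Type*} [Field K] [Field F] [Algebra K F]

theorem ratDegree_div {p q : K[X]} (hq : q ≠ 0) (hpq : IsCoprime p q) :
    ratDegree (algebraMap K[X] (RatFunc K) p / algebraMap K[X] (RatFunc K) q) =
      max p.natDegree q.natDegree := by
  classical
  have hgcd : gcd p q = 1 := by
    rw [← normalize_gcd, normalize_eq_one]
    exact (gcd_isUnit_iff p q).2 hpq
  have hlead : q.leadingCoeff⁻¹ ≠ 0 := inv_ne_zero (leadingCoeff_ne_zero.2 hq)
  rw [ratDegree, RatFunc.num_div, RatFunc.denom_div p hq, hgcd, EuclideanDomain.div_one,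
    EuclideanDomain.div_one, natDegree_C_mul hlead, natDegree_C_mul hlead]

/-- Evaluation at the generic point `X` of `F(X)` is extension of scalars from `K` to `F`. -/
theorem ratDegree_value_X (f : RatFunc K) :
    ratDegree (value f (RatFunc.X : RatFunc F)) = ratDegree f := by
  have haeval (p : K[X]) : aeval (RatFunc.X : RatFunc F) p =
      algebraMap F[X] (RatFunc F) (p.map (algebraMap K F)) := by
    rw [← aeval_map_algebraMap F, RatFunc.aeval_X_left_eq_algebraMap]
  have hcoprime := (isCoprime_map (algebraMap K F)).2 f.isCoprime_num_denom
  rw [value, haeval, haeval, ratDegree_div (Polynomial.map_ne_zero f.denom_ne_zero) hcoprime,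
    natDegree_map, natDegree_map, ratDegree]

theorem X_notMem_adjoin_of_two_le_ratDegree {r : RatFunc K} (hr : 2 ≤ ratDegree r) :
    RatFunc.X ∉ K⟮r⟯ := by
  intro hX
  have htop : K⟮r⟯ = ⊤ := by
    rw [eq_top_iff, ← RatFunc.adjoin_X]
    exact adjoin_simple_le_iff.2 hX
  have hfinrank : Module.finrank K⟮r⟯ (RatFunc K) = ratDegree r :=
    RatFunc.finrank_eq_max_natDegree r
  rw [htop, IntermediateField.finrank_top] at hfinrank
  lia

theorem notMem_adjoin_value {Ω : Type*} [Field Ω] [Algebra K Ω] [Algebra F Ω]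
    [IsScalarTower K F Ω] {f : RatFunc K} (hf : 2 ≤ ratDegree f) {s : Ω}
    (hs : Transcendental F s) : s ∉ F⟮value f s⟯ := by
  intro hmem
  let φ : RatFunc F →ₐ[F] Ω := F⟮s⟯.val.comp (RatFunc.algEquivOfTranscendental s hs).toAlgHom
  have hφX : φ RatFunc.X = s := RatFunc.algEquivOfTranscendental_X s hs
  have hφf : φ (value f RatFunc.X) = value f s := by
    rw [← hφX]
    exact map_value f (φ.restrictScalars K) _
  have hmap : φ RatFunc.X ∈ F⟮value f (RatFunc.X : RatFunc F)⟯.map φ := by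
    rwa [adjoin_map, Set.image_singleton, hφf, hφX]
  obtain ⟨y, hy, hyX⟩ := hmap
  exact X_notMem_adjoin_of_two_le_ratDegree (hf.trans_eq (ratDegree_value_X f).symm)
    (φ.injective hyX ▸ hy)

end Degree

namespace PathSystem

open MulAction (stabilizer)

variable {K Ω : Type*} [Field K] [Field Ω] [Algebra K Ω] {f : RatFunc K} {t : Ω}
  (Λ : PathSystem f t)

section Sections

theorem treeAut_ext {g h : TreeAut (Fin (ratDegree f))}
    (H : ∀ v, Λ.pt (g.1 v) = Λ.pt (h.1 v)) : g = h :=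
  Subtype.ext <| Equiv.ext fun v =>
    Λ.pt_injective _ _ ((g.2.1 v).trans (h.2.1 v).symm) (H v)

/-- The action on the tree of words of the stabilizer of `t` in `Gal(Ω/K)`, which is
`Gal(Ω/K(t))`. Keeping the whole group inside `Gal(Ω/K)` allows conjugation by paths. -/
noncomputable def treeHom : stabilizer Gal(Ω/K) t →* TreeAut (Fin (ratDegree f)) where
  toFun σ := Λ.treeAut σ.1 σ.2
  map_one' := Λ.treeAut_ext (Λ.pt_treeAut 1 rfl)
  map_mul' σ τ := Λ.treeAut_ext fun v =>
    calc Λ.pt ((Λ.treeAut (σ * τ).1 (σ * τ).2).1 v) = σ.1 (τ.1 (Λ.pt v)) :=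
          Λ.pt_treeAut _ (σ * τ).2 v
      _ = σ.1 (Λ.pt ((Λ.treeAut τ.1 τ.2).1 v)) := congrArg σ.1 (Λ.pt_treeAut _ τ.2 v).symm
      _ = _ := (Λ.pt_treeAut _ σ.2 _).symm

theorem pt_treeHom (σ : stabilizer Gal(Ω/K) t) (v : List (Fin (ratDegree f))) :
    Λ.pt ((Λ.treeHom σ).1 v) = σ.1 (Λ.pt v) :=
  Λ.pt_treeAut σ.1 σ.2 v

/-- The composite `λ_{i_1} ∘ … ∘ λ_{i_n}` of the paths along the word `i_1 … i_n`, a path from `t`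
to the point labelled by this word. -/
noncomputable def wordPath (v : List (Fin (ratDegree f))) : Gal(Ω/K) :=
  (v.map Λ.pathK).prod

theorem wordPath_pt (v w : List (Fin (ratDegree f))) :
    Λ.wordPath v (Λ.pt w) = Λ.pt (v ++ w) := by
  induction v with
  | nil => rfl
  | cons i v ih => exact congrArg (Λ.path i) ih

theorem wordPath_apply_base (v : List (Fin (ratDegree f))) : Λ.wordPath v t = Λ.pt v :=
  (Λ.wordPath_pt v []).trans (congrArg Λ.pt v.append_nil)

theorem wordPath_apply_of_mem (v : List (Fin (ratDegree f))) {x : Ω}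
    (hx : x ∈ separableClosure K Ω) : Λ.wordPath v x = x := by
  induction v with
  | nil => rfl
  | cons i v ih => exact (congrArg (Λ.path i) ih).trans ((Λ.path i).commutes ⟨x, hx⟩)

/-- The automorphism `λ_w⁻¹ ∘ σ ∘ λ_v`, where `w` is the image of `v` under `σ`; it induces the
section at `v` of the tree automorphism induced by `σ`. -/
noncomputable def sectionLift (σ : stabilizer Gal(Ω/K) t) (v : List (Fin (ratDegree f))) :
    stabilizer Gal(Ω/K) t :=
  ⟨(Λ.wordPath ((Λ.treeHom σ).1 v))⁻¹ * σ.1 * Λ.wordPath v, by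
    rw [MulAction.mem_stabilizer_iff, mul_smul, mul_smul, inv_smul_eq_iff, AlgEquiv.smul_def,
      AlgEquiv.smul_def, AlgEquiv.smul_def, wordPath_apply_base, wordPath_apply_base, pt_treeHom]⟩

theorem wordPath_sectionLift (σ : stabilizer Gal(Ω/K) t) (v : List (Fin (ratDegree f))) (x : Ω) :
    Λ.wordPath ((Λ.treeHom σ).1 v) ((Λ.sectionLift σ v).1 x) = σ.1 (Λ.wordPath v x) :=
  (Λ.wordPath ((Λ.treeHom σ).1 v)).apply_symm_apply _

theorem sec_treeHom (σ : stabilizer Gal(Ω/K) t) (v : List (Fin (ratDegree f))) :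
    TreeAut.sec (Λ.treeHom σ) v = Λ.treeHom (Λ.sectionLift σ v) := by
  refine Λ.treeAut_ext fun w => (Λ.wordPath ((Λ.treeHom σ).1 v)).injective ?_
  rw [wordPath_pt, ← TreeAut.apply_append, pt_treeHom, pt_treeHom, wordPath_sectionLift,
    wordPath_pt]

theorem sectionLift_apply_of_mem (σ : stabilizer Gal(Ω/K) t) (v : List (Fin (ratDegree f)))
    {x : Ω} (hx : x ∈ separableClosure K Ω) : (Λ.sectionLift σ v).1 x = σ.1 x := by
  rw [← Λ.wordPath_apply_of_mem ((Λ.treeHom σ).1 v) (map_mem_separableClosure _ hx),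
    wordPath_sectionLift, Λ.wordPath_apply_of_mem v hx]

theorem sectionLift_mul_inv_apply_of_mem (σ : stabilizer Gal(Ω/K) t)
    (v w : List (Fin (ratDegree f))) {x : Ω} (hx : x ∈ separableClosure K Ω) :
    (Λ.sectionLift σ v * (Λ.sectionLift σ w)⁻¹).1 x = x := by
  have hy := map_mem_separableClosure (Λ.sectionLift σ w).1⁻¹ hx
  calc (Λ.sectionLift σ v).1 ((Λ.sectionLift σ w).1⁻¹ x)
      = (Λ.sectionLift σ w).1 ((Λ.sectionLift σ w).1⁻¹ x) := by
        rw [Λ.sectionLift_apply_of_mem σ v hy, Λ.sectionLift_apply_of_mem σ w hy]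
    _ = x := (Λ.sectionLift σ w).1.apply_symm_apply x

end Sections

section IteratedGaloisGroups

variable (F : Type*) [Field F] [Algebra K F] [Algebra F Ω] [IsScalarTower K F Ω]

theorem mem_iteratedGaloisGroup_iff {g : TreeAut (Fin (ratDegree f))} :
    g ∈ Λ.iteratedGaloisGroup F ↔ ∃ σ : stabilizer Gal(Ω/K) t,
      (∀ x : F, σ.1 (algebraMap F Ω x) = algebraMap F Ω x) ∧ Λ.treeHom σ = g := by
  constructor
  · rintro ⟨σ, rfl⟩
    exact ⟨⟨_, gal_fix F σ⟩, (σ.restrictScalars F).commutes, rfl⟩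
  · rintro ⟨⟨σ, hσ⟩, hF, rfl⟩
    let σF : Ω ≃ₐ[F] Ω := .ofRingEquiv (f := σ.toRingEquiv) hF
    have hfix : ∀ x ∈ F⟮t⟯, σF x = x :=
      (forall_mem_adjoin_smul_eq_self_iff F (S := {t}) σF).2 fun _ h => h ▸ hσ
    exact ⟨.ofRingEquiv (f := σ.toRingEquiv) fun x => hfix x x.2, rfl⟩

theorem iteratedGaloisGroup_base : Λ.iteratedGaloisGroup K = Λ.treeHom.range := by
  ext g
  rw [mem_iteratedGaloisGroup_iff, MonoidHom.mem_range]
  exact exists_congr fun σ => and_iff_right σ.1.commutes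

theorem iteratedGaloisGroup_le : Λ.iteratedGaloisGroup F ≤ Λ.iteratedGaloisGroup K := by
  intro g hg
  obtain ⟨σ, -, hσ⟩ := (Λ.mem_iteratedGaloisGroup_iff F).1 hg
  exact Λ.iteratedGaloisGroup_base ▸ ⟨σ, hσ⟩

theorem iteratedGaloisGroup_eq_map (L : IntermediateField K Ω) :
    Λ.iteratedGaloisGroup L =
      (L.fixingSubgroup.subgroupOf (stabilizer Gal(Ω/K) t)).map Λ.treeHom := by
  ext g
  exact Λ.mem_iteratedGaloisGroup_iff L

theorem normal_iteratedGaloisGroup {L : IntermediateField K Ω}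
    (hL : ∀ σ : Gal(Ω/K), σ t = t → ∀ x ∈ L, σ x ∈ L) :
    ((Λ.iteratedGaloisGroup L).subgroupOf (Λ.iteratedGaloisGroup K)).Normal := by
  have hnormal : (L.fixingSubgroup.subgroupOf (stabilizer Gal(Ω/K) t)).Normal := by
    refine ⟨fun τ hτ σ x => ?_⟩
    have hx : σ.1⁻¹ x.1 ∈ L := hL _ (inv_mem σ.2) _ x.2
    calc σ.1 (τ.1 (σ.1⁻¹ x.1)) = σ.1 (σ.1⁻¹ x.1) := congrArg σ.1 (hτ ⟨_, hx⟩)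
      _ = x := σ.1.apply_symm_apply _
  rw [Subgroup.normal_subgroupOf_iff_le_normalizer (Λ.iteratedGaloisGroup_le L),
    iteratedGaloisGroup_base, iteratedGaloisGroup_eq_map, MonoidHom.range_eq_map,
    ← Subgroup.normalizer_eq_top_iff.2 hnormal]
  exact Subgroup.le_normalizer_map _

theorem isSelfSimilar_iteratedGaloisGroup [Algebra.IsSeparable K F] :
    IsSelfSimilar (Λ.iteratedGaloisGroup F) := by
  intro g hg v
  obtain ⟨σ, hσ, rfl⟩ := (Λ.mem_iteratedGaloisGroup_iff F).1 hg
  refine (Λ.mem_iteratedGaloisGroup_iff F).2 ⟨Λ.sectionLift σ v, fun x => ?_, ?_⟩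
  · rw [Λ.sectionLift_apply_of_mem σ v (algebraMap_mem_separableClosure x), hσ]
  · exact (Λ.sec_treeHom σ v).symm

theorem sec_mul_inv_sec_mem [Algebra.IsSeparable K F] {g : TreeAut (Fin (ratDegree f))}
    (hg : g ∈ Λ.iteratedGaloisGroup K) (v w : List (Fin (ratDegree f))) :
    TreeAut.sec g v * (TreeAut.sec g w)⁻¹ ∈ Λ.iteratedGaloisGroup F := by
  rw [iteratedGaloisGroup_base] at hg
  obtain ⟨σ, rfl⟩ := hg
  rw [sec_treeHom, sec_treeHom, ← map_inv, ← map_mul]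
  exact (Λ.mem_iteratedGaloisGroup_iff F).2 ⟨_, fun x =>
    Λ.sectionLift_mul_inv_apply_of_mem σ v w (algebraMap_mem_separableClosure x), rfl⟩

theorem pt_mem_adjoin_of_iteratedGaloisGroup_eq_bot [IsSepClosure K⟮t⟯ Ω]
    (hbot : Λ.iteratedGaloisGroup F = ⊥) (v : List (Fin (ratDegree f))) : Λ.pt v ∈ F⟮t⟯ := by
  have : IsSepClosure F⟮t⟯ Ω := isSepClosure_adjoin_simple (K := K) F (mem_adjoin_simple_self F t)
  suffices Λ.pt v ∈ (⊥ : IntermediateField F⟮t⟯ Ω) by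
    obtain ⟨x, hx⟩ := mem_bot.1 this
    exact hx ▸ x.2
  refine (InfiniteGalois.mem_bot_iff_fixed _).2 fun σ => ?_
  have hσ : Λ.rho F σ = 1 := Subgroup.mem_bot.1 (hbot ▸ ⟨σ, rfl⟩)
  calc σ (Λ.pt v) = Λ.pt ((Λ.rho F σ).1 v) := (Λ.pt_treeAut _ (gal_fix F σ) v).symm
    _ = Λ.pt v := by rw [hσ]; rfl

theorem iteratedGaloisGroup_ne_bot (hdeg : 2 ≤ ratDegree f) (ht : Transcendental K t)
    [IsSepClosure K⟮t⟯ Ω] [Algebra.IsAlgebraic K F] : Λ.iteratedGaloisGroup F ≠ ⊥ := by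
  intro hbot
  let i : Fin (ratDegree f) := ⟨0, by lia⟩
  have hi : value f (Λ.pt [i]) = t := Λ.iterate_pt [i]
  have hs : Transcendental F (Λ.pt [i]) :=
    (transcendental_of_value (f := f) (hi.symm ▸ ht)).extendScalars F
  refine notMem_adjoin_value hdeg hs ?_
  rw [hi]
  exact Λ.pt_mem_adjoin_of_iteratedGaloisGroup_eq_bot F hbot [i]

theorem isSelfSimilarPair_iteratedGaloisGroup (hdeg : 2 ≤ ratDegree f) (ht : Transcendental K t)
    [IsSepClosure K⟮t⟯ Ω] (L : IntermediateField K Ω) [Algebra.IsSeparable K L]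
    (hL : ∀ σ : Gal(Ω/K), σ t = t → ∀ x ∈ L, σ x ∈ L) :
    IsSelfSimilarPair (Λ.iteratedGaloisGroup K) (Λ.iteratedGaloisGroup L) where
  ne_bot := Λ.iteratedGaloisGroup_ne_bot L hdeg ht
  le := Λ.iteratedGaloisGroup_le L
  normal := Λ.normal_iteratedGaloisGroup hL
  selfSimilar_left := Λ.isSelfSimilar_iteratedGaloisGroup K
  selfSimilar_right := Λ.isSelfSimilar_iteratedGaloisGroup L

end IteratedGaloisGroups

end PathSystem

section ConstantField

variable {K Ω : Type*} [Field K] [Field Ω] [Algebra K Ω] (f : RatFunc K) {t : Ω} (n : ℕ∞)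

theorem map_mem_splittingField (σ : Gal(Ω/K)) (hσ : σ t = t) :
    ∀ x ∈ splittingField f t n, σ x ∈ splittingField f t n := by
  suffices splittingField f t n ≤ (splittingField f t n).comap σ.toAlgHom from this
  refine adjoin_le_iff.2 ?_
  rintro x (rfl | ⟨k, hk, hx⟩)
  · exact subset_adjoin K _ (.inl hσ)
  · have hσx : (value f)^[k] (σ x) = t := by rw [value_iterate_map, hx, hσ]
    exact subset_adjoin K _ (.inr ⟨k, hk, hσx⟩)

theorem map_mem_constantField (σ : Gal(Ω/K)) (hσ : σ t = t) :
    ∀ x ∈ constantField f t n, σ x ∈ constantField f t n := fun x hx =>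
  ⟨map_mem_separableClosure σ hx.1, map_mem_splittingField f n σ hσ x hx.2⟩

instance isSeparable_constantField : Algebra.IsSeparable K (constantField f t n) :=
  (le_separableClosure_iff K Ω _).1 inf_le_left

end ConstantField

end Arboreal

open Arboreal in
theorem proposition3p2_general {K Ω : Type*} [Field K] [Field Ω] [Algebra K Ω]
    (f : RatFunc K) (hdeg : 2 ≤ ratDegree f) (hsep : IsSeparableMap f)
    (t : Ω) (ht : Transcendental K t) [IsSepClosure (IntermediateField.adjoin K {t}) Ω] :
    Nonempty (PathSystem f t) ∧
    ∀ (Λ : PathSystem f t) (L : IntermediateField K Ω) [Algebra.IsSeparable K L],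
      (∀ σ : Gal(Ω/K), σ t = t → ∀ x ∈ L, σ x ∈ L) →
      IsSelfSimilarPair (Λ.iteratedGaloisGroup K) (Λ.iteratedGaloisGroup L) ∧
      (Λ.iteratedGaloisGroup K : Set (TreeAut (Fin (ratDegree f)))) =
        intermediate (Λ.iteratedGaloisGroup K) (Λ.iteratedGaloisGroup L) := by
  refine ⟨nonempty_pathSystem hsep ht, fun Λ L _ hL =>
    ⟨Λ.isSelfSimilarPair_iteratedGaloisGroup hdeg ht L hL, Set.Subset.antisymm ?_ ?_⟩⟩
  · exact fun g hg => ⟨hg, Λ.sec_mul_inv_sec_mem L hg⟩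
  · exact fun g hg => hg.1

open Arboreal in
theorem proposition3p2 {K Ω : Type*} [Field K] [Field Ω] [Algebra K Ω]
    (f : RatFunc K) (hdeg : 2 ≤ ratDegree f) (hsep : IsSeparableMap f)
    (t : Ω) (ht : Transcendental K t) [IsSepClosure (IntermediateField.adjoin K {t}) Ω] :
    Nonempty (PathSystem f t) ∧
    ∀ (Λ : PathSystem f t) (n : ℕ∞), 1 ≤ n →
      IsSelfSimilarPair (Λ.iteratedGaloisGroup K)
        (Λ.iteratedGaloisGroup (constantField f t n)) ∧
      (Λ.iteratedGaloisGroup K : Set (TreeAut (Fin (ratDegree f)))) =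
        intermediate (Λ.iteratedGaloisGroup K) (Λ.iteratedGaloisGroup (constantField f t n)) :=
  (proposition3p2_general f hdeg hsep t ht).imp_right fun h Λ n _ =>
    h Λ (constantField f t n) (map_mem_constantField f n)
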